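/- **Setting.** Let $H_S=\sum_i \epsilon_i |\epsilon_i\rangle\langle\epsilon_i|$ be the Hamiltonian of a finite-dimensional quantum system $S$ (energies real, possibly degenerate). The weight $W$ has Hilbert space $L^2(\mathbb R)$, its Hamiltonian $H_W$ is multiplication by the energy variable $E$, and $\Delta_W$ is the generator of the displacements $\Gamma_a=e^{-ia\Delta_W}$, $(\Gamma_a\psi)(E)=\psi(E-a)$, so that $\Gamma_a^\dagger H_W\Gamma_a=H_W+a$. Let $S=e^{-iH_S\otimes\Delta_W}=\sum_i|\epsilon_i\rangle\langle\epsilon_i|\otimes\Gamma_{\epsilon_i}$, let $V_S$ be a unitary on the system, $U=S^\dagger (V_S\otimes 1) S$, and $W_S=H_S-V_S^\dagger H_SV_S$. For density operators $\rho_S$ and $\rho_W$ of the system and the weight, the final state of the weight is $\rho_W'=\mathrm{Tr}_S[U(\rho_S\otimes\rho_W)U^\dagger]$. The energy distribution of a weight state $\rho$ is the probability measure $B\mapsto \mathrm{Tr}[\rho\,1_B(H_W)]$ on $\mathbb R$. Denote by $\sigma_E^{(i)},\sigma_E^{(f)}\in[0,\infty]$ the standard deviations of the energy distributions of $\rho_W$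 and $\rho_W'$ (equal to $\infty$ if there is no finite second moment), by $\Delta E_W$ the mean of the energy distribution of $\rho_W'$ minus that of $\rho_W$, and by $\Delta\sigma_W^2$ the variance of the energy distribution of $\rho_W'$ minus that of $\rho_W$. Write $\langle A\rangle_{\rho_S}=\mathrm{Tr}[A\rho_S]$ and $\mathrm{Var}_{\rho_S}[A]=\langle A^2\rangle_{\rho_S}-\langle A\rangle_{\rho_S}^2$. **Corollary (incoherent work extraction).** Suppose that $[W_S,H_S]=0$, or that $\rho_S$ is incoherent, i.e. $[\rho_S,H_S]=0$. Then $\Delta E_W$ and $\Delta\sigma_W^2$ do not depend on the state of the weight. Precisely: 1. If the energy distribution of $\rho_W$ has a finite first moment, then so has that of $\rho_W'$, and $\Delta E_W=\langle W_S\rangle_{\rho_S}$. 2. If the energy distribution of $\rho_W$ has a finite second moment, then so has that of $\rho_W'$, and $\Delta\sigma_W^2=\mathrm{Var}_{\rho_S}[W_S]$. 3. There is no constraint on the initial dispersion: for every real $s>0$ there is a weight state $\rho_W$ with finite second moment of the energy, with $\sigma_E^{(i)}=s$, and with these same values of $\Delta E_W$ and $\Delta\sigma_W^2$. 4. For every weight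 state $\rho_W$ the final dispersion satisfies $\sigma_E^{(f)}\ge\sqrt{\mathrm{Var}_{\rho_S}[W_S]}$, i.e. the final energy variance is at least $\mathrm{Var}_{\rho_S}[W_S]$. -/

import Mathlib

open MeasureTheory ProbabilityTheory
open scoped ENNReal ComplexOrder

noncomputable section

/-! ### Density operators -/

theorem enorm_sq_eq_tsum {E : Type*} [NormedAddCommGroup E] [InnerProductSpace ℂ E] {κ : Type*}
    (b : HilbertBasis κ ℂ E) (x : E) :
    ‖x‖ₑ ^ 2 = ∑' k, ‖inner ℂ (b k) x‖ₑ ^ 2 := by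
  have h := b.hasSum_inner_mul_inner x x
  have h2 : HasSum (fun k => ‖inner ℂ (b k) x‖ ^ 2) (‖x‖ ^ 2) := by
    have h3 := Complex.hasSum_re h
    have h4 : (inner ℂ x x : ℂ).re = ‖x‖ ^ 2 := by
      rw [← inner_self_eq_norm_sq (𝕜 := ℂ)]; rfl
    rw [h4] at h3
    refine h3.congr_fun ?_ |> fun h => h
    intro k
    rw [← inner_conj_symm x (b k), ← Complex.normSq_eq_conj_mul_self, Complex.ofReal_re,
      Complex.normSq_eq_norm_sq]
  have h5 := ENNReal.ofReal_tsum_of_nonneg (fun k => by positivity) h2.summable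
  rw [h2.tsum_eq] at h5
  simpa [← ofReal_norm, ENNReal.ofReal_pow] using h5

section Density

variable {E : Type*} [NormedAddCommGroup E] [InnerProductSpace ℂ E] [CompleteSpace E]

/-- A fixed Hilbert basis of a complex Hilbert space, as a set of vectors. -/
def hilbertBasisSet (E : Type*) [NormedAddCommGroup E] [InnerProductSpace ℂ E]
    [CompleteSpace E] : Set E :=
  (exists_hilbertBasis ℂ E).choose

/-- The trace `∑ₑ ⟪e, T e⟫ ∈ [0, ∞]` of a positive bounded operator `T`. For positive operators
it does not depend on the Hilbert basis, see `posTrace_eq`. -/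
def posTrace (T : E →L[ℂ] E) : ℝ≥0∞ :=
  ∑' e : hilbertBasisSet E, ENNReal.ofReal (inner ℂ (e : E) (T e)).re

/-- A density operator: positive, trace class, of trace one. -/
structure IsDensityOperator (ρ : E →L[ℂ] E) : Prop where
  isPositive : ρ.IsPositive
  trace_eq_one : posTrace ρ = 1

/-- The Hilbert-Schmidt norm is the same for an operator and its adjoint, in any two bases. -/
theorem tsum_enorm_sq_comm {κ κ' : Type*} (b : HilbertBasis κ ℂ E) (c : HilbertBasis κ' ℂ E)
    (A : E →L[ℂ] E) :
    ∑' k, ‖A (b k)‖ₑ ^ 2 = ∑' l, ‖ContinuousLinearMap.adjoint A (c l)‖ₑ ^ 2 := by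
  simp_rw [enorm_sq_eq_tsum c (A _), enorm_sq_eq_tsum b (ContinuousLinearMap.adjoint A _)]
  rw [ENNReal.tsum_comm]
  refine tsum_congr fun l => tsum_congr fun k => ?_
  rw [ContinuousLinearMap.adjoint_inner_right, ← inner_conj_symm]
  rw [← ofReal_norm, ← ofReal_norm, RCLike.norm_conj]

/-- The positive square root of a positive operator. -/
def opSqrt (ρ : E →L[ℂ] E) : E →L[ℂ] E := CFC.sqrt ρ

theorem opSqrt_adjoint (ρ : E →L[ℂ] E) :
    ContinuousLinearMap.adjoint (opSqrt ρ) = opSqrt ρ :=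
  (IsSelfAdjoint.of_nonneg (CFC.sqrt_nonneg ρ)).star_eq

theorem inner_conj_eq {ρ : E →L[ℂ] E} (hρ : ρ.IsPositive) (P : E →L[ℂ] E) (x : E) :
    ENNReal.ofReal (inner ℂ x ((ContinuousLinearMap.adjoint P ∘L ρ ∘L P) x)).re
      = ‖(opSqrt ρ ∘L P) x‖ₑ ^ 2 := by
  have h : opSqrt ρ * opSqrt ρ = ρ :=
    CFC.sqrt_mul_sqrt_self ρ ((ContinuousLinearMap.nonneg_iff_isPositive ρ).2 hρ)
  have h1 : ρ (P x) = opSqrt ρ (opSqrt ρ (P x)) := by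
    conv_lhs => rw [← h]
    rfl
  simp only [ContinuousLinearMap.comp_apply, ContinuousLinearMap.adjoint_inner_right]
  rw [h1, ← ContinuousLinearMap.adjoint_inner_left, opSqrt_adjoint]
  have h4 : (inner ℂ (opSqrt ρ (P x)) (opSqrt ρ (P x)) : ℂ).re = ‖opSqrt ρ (P x)‖ ^ 2 := by
    rw [← inner_self_eq_norm_sq (𝕜 := ℂ)]; rfl
  rw [h4, ENNReal.ofReal_pow (norm_nonneg _), ofReal_norm]

theorem hilbertBasisSet_spec :
    ∃ b : HilbertBasis (hilbertBasisSet E) ℂ E, ⇑b = ((↑) : hilbertBasisSet E → E) :=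
  (exists_hilbertBasis ℂ E).choose_spec

/-- The trace of a positive operator can be computed in any Hilbert basis. -/
theorem posTrace_eq {κ : Type*} (b : HilbertBasis κ ℂ E) {T : E →L[ℂ] E} (hT : T.IsPositive) :
    posTrace T = ∑' k, ENNReal.ofReal (inner ℂ (b k) (T (b k))).re := by
  obtain ⟨c, hc⟩ := hilbertBasisSet_spec (E := E)
  have key : ∀ x, ENNReal.ofReal (inner ℂ x (T x)).re = ‖opSqrt T x‖ₑ ^ 2 := by
    intro x
    have h := inner_conj_eq hT (ContinuousLinearMap.id ℂ E) x
    simpa only [ContinuousLinearMap.adjoint_id, ContinuousLinearMap.id_comp,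
      ContinuousLinearMap.comp_id] using h
  unfold posTrace
  simp_rw [key]
  have h := tsum_enorm_sq_comm c b (opSqrt T)
  rw [hc, opSqrt_adjoint] at h
  exact h

end Density

/-! ### The quantum weight, in the energy representation -/

/-- The Hilbert space `L²(ℝ)` of the weight. The variable is the energy `E`, so that the
Hamiltonian `H_W` is multiplication by `E`. -/
abbrev WeightSpace : Type := Lp ℂ 2 (volume : Measure ℝ)

/-- The displacement operator `Γ_a = exp (-i a Δ_W)`, `(Γ_a ψ)(E) = ψ (E - a)`; it satisfies
`Γ_a† H_W Γ_a = H_W + a`. -/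
def displacement (a : ℝ) : WeightSpace →L[ℂ] WeightSpace :=
  (Lp.compMeasurePreservingₗᵢ ℂ (fun x : ℝ => x - a)
    (measurePreserving_sub_right volume a)).toContinuousLinearMap

/-- Multiplication by the indicator function of `B`, as a map. -/
def indicatorFun (B : Set ℝ) (hB : MeasurableSet B) (f : WeightSpace) : WeightSpace :=
  ((Lp.memLp f).indicator hB).toLp _

theorem indicatorFun_coe (B : Set ℝ) (hB : MeasurableSet B) (f : WeightSpace) :
    indicatorFun B hB f =ᵐ[volume] B.indicator f :=
  MemLp.coeFn_toLp _

theorem indicatorFun_add (B : Set ℝ) (hB : MeasurableSet B) (f g : WeightSpace) :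
    indicatorFun B hB (f + g) = indicatorFun B hB f + indicatorFun B hB g := by
  apply Lp.ext
  filter_upwards [indicatorFun_coe B hB (f + g), indicatorFun_coe B hB f,
    indicatorFun_coe B hB g, Lp.coeFn_add f g,
    Lp.coeFn_add (indicatorFun B hB f) (indicatorFun B hB g)] with x h1 h2 h3 h4 h5
  rw [h1, h5, Pi.add_apply, h2, h3]
  by_cases h : x ∈ B <;> simp only [h, Set.indicator_of_mem, Set.indicator_of_notMem,
    not_false_eq_true, h4, Pi.add_apply, add_zero]

theorem indicatorFun_smul (B : Set ℝ) (hB : MeasurableSet B) (c : ℂ) (f : WeightSpace) :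
    indicatorFun B hB (c • f) = c • indicatorFun B hB f := by
  apply Lp.ext
  filter_upwards [indicatorFun_coe B hB (c • f), indicatorFun_coe B hB f,
    Lp.coeFn_smul c f, Lp.coeFn_smul c (indicatorFun B hB f)] with x h1 h2 h3 h4
  rw [h1, h4, Pi.smul_apply, h2]
  by_cases h : x ∈ B <;> simp only [h, Set.indicator_of_mem, Set.indicator_of_notMem,
    not_false_eq_true, h3, Pi.smul_apply, smul_zero]

theorem norm_indicatorFun_le (B : Set ℝ) (hB : MeasurableSet B) (f : WeightSpace) :
    ‖indicatorFun B hB f‖ ≤ 1 * ‖f‖ := by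
  rw [one_mul]
  refine Lp.norm_le_norm_of_ae_le ?_
  filter_upwards [indicatorFun_coe B hB f] with x hx
  rw [hx]
  exact norm_indicator_le_norm_self _ _

/-- The spectral projection `1_B(H_W)`: multiplication by the indicator function of `B`. -/
def energyProj (B : Set ℝ) (hB : MeasurableSet B) : WeightSpace →L[ℂ] WeightSpace :=
  LinearMap.mkContinuous
    { toFun := indicatorFun B hB
      map_add' := indicatorFun_add B hB
      map_smul' := indicatorFun_smul B hB } 1
    (norm_indicatorFun_le B hB)

/-- The energy distribution of a weight state `ρ`, i.e. the measure with density
`f(E) = ⟨E|ρ|E⟩ = ∑ₑ |(√ρ e)(E)|²`. By `energyDist_apply` it is the Born rule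
`B ↦ Tr[1_B(H_W) ρ 1_B(H_W)] = Tr[ρ 1_B(H_W)]`. -/
def energyDist (ρ : WeightSpace →L[ℂ] WeightSpace) : Measure ℝ :=
  Measure.sum fun e : hilbertBasisSet WeightSpace =>
    volume.withDensity fun x => ‖(opSqrt ρ (e : WeightSpace) : WeightSpace) x‖ₑ ^ 2

theorem enorm_energyProj_sq (B : Set ℝ) (hB : MeasurableSet B) (f : WeightSpace) :
    ‖energyProj B hB f‖ₑ ^ 2 = ∫⁻ x in B, ‖f x‖ₑ ^ 2 := by
  have h1 : ‖energyProj B hB f‖ₑ = eLpNorm (B.indicator f) 2 volume := by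
    change ‖((Lp.memLp f).indicator hB).toLp _‖ₑ = _
    rw [Lp.enorm_toLp]
  rw [h1, eLpNorm_indicator_eq_eLpNorm_restrict hB,
    eLpNorm_eq_lintegral_rpow_enorm_toReal (by norm_num) (by norm_num)]
  simp only [ENNReal.toReal_ofNat]
  rw [← ENNReal.rpow_natCast, ← ENNReal.rpow_mul]
  norm_num

theorem energyProj_adjoint (B : Set ℝ) (hB : MeasurableSet B) :
    ContinuousLinearMap.adjoint (energyProj B hB) = energyProj B hB := by
  symm
  rw [ContinuousLinearMap.eq_adjoint_iff]
  intro f g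
  rw [L2.inner_def, L2.inner_def]
  refine integral_congr_ae ?_
  filter_upwards [indicatorFun_coe B hB f, indicatorFun_coe B hB g] with x hf hg
  have hf' : (energyProj B hB f : WeightSpace) x = B.indicator f x := hf
  have hg' : (energyProj B hB g : WeightSpace) x = B.indicator g x := hg
  rw [hf', hg']
  by_cases h : x ∈ B <;> simp [h]

/-- The Born rule. -/
theorem energyDist_apply {ρ : WeightSpace →L[ℂ] WeightSpace} (hρ : ρ.IsPositive)
    (B : Set ℝ) (hB : MeasurableSet B) :
    energyDist ρ B = posTrace (energyProj B hB ∘L ρ ∘L energyProj B hB) := by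
  obtain ⟨c, hc⟩ := hilbertBasisSet_spec (E := WeightSpace)
  have h := tsum_enorm_sq_comm c c (opSqrt ρ ∘L energyProj B hB)
  rw [ContinuousLinearMap.adjoint_comp, opSqrt_adjoint, energyProj_adjoint, hc] at h
  have h2 := fun x => inner_conj_eq hρ (energyProj B hB) x
  rw [energyProj_adjoint] at h2
  unfold posTrace
  simp_rw [h2]
  rw [h, energyDist, Measure.sum_apply _ hB]
  refine tsum_congr fun e => ?_
  rw [withDensity_apply _ hB, ContinuousLinearMap.comp_apply, enorm_energyProj_sq]

/-- The mean energy `⟨H_W⟩_ρ` (meaningful when the energy distribution has a first moment). -/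
def meanEnergy (ρ : WeightSpace →L[ℂ] WeightSpace) : ℝ := ∫ x, x ∂(energyDist ρ)

/-- The energy variance `Var_ρ[H_W]` (meaningful when there is a second moment). -/
def varEnergy (ρ : WeightSpace →L[ℂ] WeightSpace) : ℝ := variance id (energyDist ρ)

/-- The energy dispersion `σ_E ∈ [0, ∞]`: the standard deviation of the energy distribution. It is
`∞` when there is no finite second moment. -/
def dispersion (ρ : WeightSpace →L[ℂ] WeightSpace) : ℝ≥0∞ :=
  (evariance id (energyDist ρ)) ^ (1 / 2 : ℝ)

/-! ### The system, in an eigenbasis of its Hamiltonian -/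

section System

variable {ι : Type*} [Fintype ι] [DecidableEq ι]

/-- The Hamiltonian `H_S = ∑ᵢ εᵢ |εᵢ⟩⟨εᵢ|`. Energies may coincide. -/
def sysHam (ε : ι → ℝ) : Matrix ι ι ℂ := Matrix.diagonal fun i => (ε i : ℂ)

/-- The work operator `W_S = H_S - V_S† H_S V_S`. -/
def workOp (ε : ι → ℝ) (V : Matrix ι ι ℂ) : Matrix ι ι ℂ :=
  sysHam ε - V.conjTranspose * sysHam ε * V

/-- A density matrix of the system. -/
structure IsDensityMatrix (ρ : Matrix ι ι ℂ) : Prop where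
  posSemidef : ρ.PosSemidef
  trace_eq_one : ρ.trace = 1

/-- `⟨A⟩_ρ = Tr[A ρ]`, which is real for Hermitian `A` and `ρ`. -/
def sysMean (ρ A : Matrix ι ι ℂ) : ℝ := (A * ρ).trace.re

/-- `Var_ρ[A] = ⟨A²⟩_ρ - ⟨A⟩_ρ²`. -/
def sysVar (ρ A : Matrix ι ι ℂ) : ℝ := sysMean ρ (A * A) - sysMean ρ A ^ 2

/-! ### System and weight -/

/-- The Hilbert space `ℂ^ι ⊗ L²(ℝ)`, as the Hilbert sum of one copy of `L²(ℝ)` for every energy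
eigenstate `i`: the vector `∑ᵢ |εᵢ⟩ ⊗ ψᵢ` is the family `(ψᵢ)`. -/
abbrev JointSpace (ι : Type*) : Type _ := PiLp 2 fun _ : ι => WeightSpace

/-- `⟨εᵢ| ⊗ 1`. -/
def braOp (i : ι) : JointSpace ι →L[ℂ] WeightSpace :=
  PiLp.proj 2 (fun _ : ι => WeightSpace) i

/-- `|εᵢ⟩ ⊗ 1`. -/
def ketOp (i : ι) : WeightSpace →L[ℂ] JointSpace ι :=
  ContinuousLinearMap.adjoint (braOp i)

theorem ketOp_apply (i : ι) (ψ : WeightSpace) : ketOp i ψ = PiLp.single 2 i ψ := by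
  refine ext_inner_right ℂ fun φ => ?_
  rw [ketOp, ContinuousLinearMap.adjoint_inner_left, PiLp.inner_apply,
    Finset.sum_eq_single i]
  · simp [braOp]
  · intro j _ hj
    simp [PiLp.single_eq_of_ne, hj]
  · simp

/-- The operator `A ⊗ T = ∑ᵢⱼ Aᵢⱼ |εᵢ⟩⟨εⱼ| ⊗ T`. -/
def tensorOp (A : Matrix ι ι ℂ) (T : WeightSpace →L[ℂ] WeightSpace) :
    JointSpace ι →L[ℂ] JointSpace ι :=
  ∑ i, ∑ j, A i j • (ketOp i ∘L T ∘L braOp j)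

/-- `S = exp (-i H_S ⊗ Δ_W) = ∑ᵢ |εᵢ⟩⟨εᵢ| ⊗ Γ_{εᵢ}`. -/
def shiftOp (ε : ι → ℝ) : JointSpace ι →L[ℂ] JointSpace ι :=
  ∑ i, ketOp i ∘L displacement (ε i) ∘L braOp i

/-- `U = S† V_S S`. -/
def protocolUnitary (ε : ι → ℝ) (V : Matrix ι ι ℂ) : JointSpace ι →L[ℂ] JointSpace ι :=
  ContinuousLinearMap.adjoint (shiftOp ε) ∘L
    tensorOp V (ContinuousLinearMap.id ℂ WeightSpace) ∘L shiftOp ε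

/-- The partial trace `Tr_S[R] = ∑ᵢ (⟨εᵢ| ⊗ 1) R (|εᵢ⟩ ⊗ 1)`. -/
def partialTraceS (R : JointSpace ι →L[ℂ] JointSpace ι) : WeightSpace →L[ℂ] WeightSpace :=
  ∑ i, braOp i ∘L R ∘L ketOp i

/-- The final state of the weight, `Tr_S[U (ρ_S ⊗ ρ_W) U†]`. -/
def finalWeight (ε : ι → ℝ) (V ρS : Matrix ι ι ℂ) (ρW : WeightSpace →L[ℂ] WeightSpace) :
    WeightSpace →L[ℂ] WeightSpace :=
  partialTraceS (protocolUnitary ε V ∘L tensorOp ρS ρW ∘L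
    ContinuousLinearMap.adjoint (protocolUnitary ε V))

/-- The extracted work `ΔE_W`: the gain of mean energy of the weight. -/
def workGain (ε : ι → ℝ) (V ρS : Matrix ι ι ℂ) (ρW : WeightSpace →L[ℂ] WeightSpace) : ℝ :=
  meanEnergy (finalWeight ε V ρS ρW) - meanEnergy ρW

/-- The gain `Δσ_W²` of the energy variance of the weight. -/
def varianceGain (ε : ι → ℝ) (V ρS : Matrix ι ι ℂ) (ρW : WeightSpace →L[ℂ] WeightSpace) : ℝ :=
  varEnergy (finalWeight ε V ρS ρW) - varEnergy ρW

end System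

end

/-!
Since `V_S ⊗ 1` commutes with displacements of the weight, the final weight state is
`∑ᵢⱼₖ Vᵢⱼ ρⱼₖ conj(Vᵢₖ) Γ_{εⱼ-εᵢ} ρ_W Γ_{εₖ-εᵢ}†`. The terms with `εⱼ ≠ εₖ` cancel when summed
over the `i` of an energy level `e`: either `ρⱼₖ = 0`, or `V_S† 1_{e}(H_S) V_S` commutes with `H_S`
because `V_S† H_S V_S = H_S - W_S` does. What is left is a mixture of displaced copies of `ρ_W`,
weighted by the two-point measurement probabilities, so the energy distribution of the weight is
convolved with the two-point work distribution. The latter has mean `⟨W_S⟩` and second moment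
`⟨W_S²⟩`, and means and variances are additive under convolution. A pure state of the weight with
Gaussian energy density has any prescribed dispersion.
-/

open ContinuousLinearMap (adjoint)

section PosTrace

variable {E : Type*} [NormedAddCommGroup E] [InnerProductSpace ℂ E] [CompleteSpace E]

theorem posTrace_finsetSum_smul {κ : Type*} {s : Finset κ} {c : κ → ℝ} (hc : ∀ k ∈ s, 0 ≤ c k)
    {T : κ → E →L[ℂ] E} (hT : ∀ k ∈ s, (T k).IsPositive) :
    posTrace (∑ k ∈ s, (c k : ℂ) • T k) = ∑ k ∈ s, ENNReal.ofReal (c k) * posTrace (T k) := by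
  have hnonneg (e : E) (k : κ) (hk : k ∈ s) : 0 ≤ c k * (inner ℂ e (T k e)).re :=
    mul_nonneg (hc k hk) ((hT k hk).re_inner_nonneg_right e)
  simp only [posTrace, ← ENNReal.tsum_mul_left]
  rw [← Summable.tsum_finsetSum fun _ _ => ENNReal.summable]
  refine tsum_congr fun e => ?_
  simp only [sum_apply, smul_apply, inner_sum, inner_smul_right, Complex.re_sum,
    Complex.re_ofReal_mul]
  rw [ENNReal.ofReal_sum_of_nonneg (hnonneg e)]
  exact Finset.sum_congr rfl fun k hk => ENNReal.ofReal_mul (hc k hk)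

theorem posTrace_comp_comp_adjoint {T : E →L[ℂ] E} (hT : T.IsPositive) {U : E →L[ℂ] E}
    (hU : ∀ x, ‖U x‖ = ‖x‖) : posTrace (U ∘L T ∘L adjoint U) = posTrace T := by
  obtain ⟨b, hb⟩ := hilbertBasisSet_spec (E := E)
  have hcomm := tsum_enorm_sq_comm b b (opSqrt T ∘L adjoint U)
  have hconj := inner_conj_eq hT (adjoint U)
  have hid := inner_conj_eq hT (.id ℂ E)
  simp only [ContinuousLinearMap.adjoint_comp, ContinuousLinearMap.adjoint_adjoint,
    opSqrt_adjoint, ContinuousLinearMap.adjoint_id, ContinuousLinearMap.comp_id,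
    ContinuousLinearMap.id_comp, hb] at hcomm hconj hid
  simp only [posTrace, hconj, hid, hcomm]
  refine tsum_congr fun e => ?_
  rw [ContinuousLinearMap.comp_apply, ← ofReal_norm, hU, ofReal_norm]

theorem posTrace_rankOne_self (ψ : E) :
    posTrace (InnerProductSpace.rankOne ℂ ψ ψ) = ‖ψ‖ₑ ^ 2 := by
  obtain ⟨b, hb⟩ := hilbertBasisSet_spec (E := E)
  rw [enorm_sq_eq_tsum b, hb, posTrace]
  refine tsum_congr fun e => ?_
  rw [InnerProductSpace.rankOne_apply, inner_smul_right, ← inner_conj_symm ψ (e : E),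
    Complex.conj_mul', ← ofReal_norm, ← ENNReal.ofReal_pow (norm_nonneg _)]
  norm_cast

end PosTrace

section EnergyDistribution

theorem displacement_coe (a : ℝ) (ψ : WeightSpace) :
    displacement a ψ =ᵐ[volume] fun x => ψ (x - a) :=
  Lp.coeFn_compMeasurePreserving ψ (measurePreserving_sub_right volume a)

theorem norm_displacement_apply (a : ℝ) (ψ : WeightSpace) : ‖displacement a ψ‖ = ‖ψ‖ :=
  LinearIsometry.norm_map _ ψ

theorem displacement_comp_displacement (a b : ℝ) :
    displacement a ∘L displacement b = displacement (a + b) := by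
  ext1 ψ
  apply Lp.ext
  have hshift := (measurePreserving_sub_right volume a).quasiMeasurePreserving.ae_eq_comp
    (displacement_coe b ψ)
  filter_upwards [displacement_coe a (displacement b ψ), displacement_coe (a + b) ψ, hshift]
    with x hab hsum hb
  rw [ContinuousLinearMap.comp_apply, hab, hsum, ← sub_sub]
  exact hb

theorem displacement_zero : displacement 0 = .id ℂ WeightSpace := by
  ext1 ψ
  apply Lp.ext
  filter_upwards [displacement_coe 0 ψ] with x hx
  rw [hx, sub_zero, ContinuousLinearMap.id_apply]

theorem adjoint_displacement (a : ℝ) : adjoint (displacement a) = displacement (-a) := by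
  have hisometry : adjoint (displacement a) ∘L displacement a = .id ℂ WeightSpace :=
    (displacement a).norm_map_iff_adjoint_comp_self.1 (norm_displacement_apply a)
  calc adjoint (displacement a)
      = adjoint (displacement a) ∘L displacement a ∘L displacement (-a) := by
        rw [displacement_comp_displacement, add_neg_cancel, displacement_zero,
          ContinuousLinearMap.comp_id]
    _ = displacement (-a) := by
        rw [← ContinuousLinearMap.comp_assoc, hisometry, ContinuousLinearMap.id_comp]

theorem energyProj_comp_displacement {B : Set ℝ} (hB : MeasurableSet B) (a : ℝ) :
    energyProj B hB ∘L displacement a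
      = displacement a ∘L energyProj ((· + a) ⁻¹' B) (hB.preimage (by fun_prop)) := by
  ext1 ψ
  apply Lp.ext
  have hshift := (measurePreserving_sub_right volume a).quasiMeasurePreserving.ae_eq_comp
    (indicatorFun_coe ((· + a) ⁻¹' B) (hB.preimage (by fun_prop)) ψ)
  filter_upwards [indicatorFun_coe B hB (displacement a ψ), displacement_coe a ψ,
    displacement_coe a (energyProj ((· + a) ⁻¹' B) (hB.preimage (by fun_prop)) ψ), hshift]
    with x hproj hdisp hdispProj hprojShift
  classical
  calc (energyProj B hB (displacement a ψ)) x
      = B.indicator (displacement a ψ) x := hproj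
    _ = ((· + a) ⁻¹' B).indicator ψ (x - a) := by
        simp only [Set.indicator_apply, Set.mem_preimage, sub_add_cancel, hdisp]
    _ = _ := hprojShift.symm.trans hdispProj.symm

theorem energyDist_finsetSum_smul {κ : Type*} {s : Finset κ} {c : κ → ℝ} (hc : ∀ k ∈ s, 0 ≤ c k)
    {ρ : κ → WeightSpace →L[ℂ] WeightSpace} (hρ : ∀ k ∈ s, (ρ k).IsPositive) :
    energyDist (∑ k ∈ s, (c k : ℂ) • ρ k)
      = ∑ k ∈ s, ENNReal.ofReal (c k) • energyDist (ρ k) := by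
  have hpos : (∑ k ∈ s, (c k : ℂ) • ρ k).IsPositive := by
    refine ContinuousLinearMap.isPositive_sum s fun k hk => (hρ k hk).smul_of_nonneg ?_
    exact_mod_cast hc k hk
  have hconj (B : Set ℝ) (hB : MeasurableSet B) (k : κ) (hk : k ∈ s) :
      (energyProj B hB ∘L ρ k ∘L energyProj B hB).IsPositive := by
    simpa only [energyProj_adjoint] using (hρ k hk).conj_adjoint (energyProj B hB)
  ext B hB
  simp only [energyDist_apply hpos B hB, ContinuousLinearMap.finsetSum_comp,
    ContinuousLinearMap.comp_finsetSum, ContinuousLinearMap.smul_comp,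
    ContinuousLinearMap.comp_smul, posTrace_finsetSum_smul hc (hconj B hB),
    Measure.coe_finsetSum, Finset.sum_apply, Measure.smul_apply, smul_eq_mul]
  exact Finset.sum_congr rfl fun k hk => by rw [energyDist_apply (hρ k hk) B hB]

theorem energyDist_displacement_comp_comp_adjoint {ρ : WeightSpace →L[ℂ] WeightSpace}
    (hρ : ρ.IsPositive) (a : ℝ) :
    energyDist (displacement a ∘L ρ ∘L adjoint (displacement a))
      = (energyDist ρ).map (· + a) := by
  ext B hB
  have hB' : MeasurableSet ((· + a) ⁻¹' B) := hB.preimage (by fun_prop)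
  have hpos := hρ.conj_adjoint (energyProj _ hB')
  rw [energyProj_adjoint] at hpos
  have hcomm := energyProj_comp_displacement hB a
  have hcomm' := congrArg adjoint hcomm
  simp only [ContinuousLinearMap.adjoint_comp, energyProj_adjoint] at hcomm'
  rw [Measure.map_apply (by fun_prop) hB, energyDist_apply hρ _ hB',
    energyDist_apply (hρ.conj_adjoint _) B hB,
    ← posTrace_comp_comp_adjoint hpos (norm_displacement_apply a)]
  congr 1
  calc energyProj B hB ∘L (displacement a ∘L ρ ∘L adjoint (displacement a)) ∘L energyProj B hB
      = (energyProj B hB ∘L displacement a) ∘L ρ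
          ∘L (adjoint (displacement a) ∘L energyProj B hB) := by
        simp only [ContinuousLinearMap.comp_assoc]
    _ = displacement a ∘L (energyProj _ hB' ∘L ρ ∘L energyProj _ hB')
          ∘L adjoint (displacement a) := by
        simp only [hcomm, hcomm', ContinuousLinearMap.comp_assoc]

theorem energyProj_univ : energyProj Set.univ .univ = .id ℂ WeightSpace := by
  ext1 ψ
  apply Lp.ext
  filter_upwards [indicatorFun_coe Set.univ .univ ψ] with x hx
  rwa [Set.indicator_univ] at hx

theorem energyDist_univ {ρ : WeightSpace →L[ℂ] WeightSpace} (hρ : ρ.IsPositive) :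
    energyDist ρ Set.univ = posTrace ρ := by
  rw [energyDist_apply hρ _ .univ, energyProj_univ, ContinuousLinearMap.comp_id,
    ContinuousLinearMap.id_comp]

theorem IsDensityOperator.isProbabilityMeasure_energyDist
    {ρ : WeightSpace →L[ℂ] WeightSpace} (hρ : IsDensityOperator ρ) :
    IsProbabilityMeasure (energyDist ρ) :=
  ⟨(energyDist_univ hρ.isPositive).trans hρ.trace_eq_one⟩

theorem energyDist_rankOne_self (ψ : WeightSpace) :
    energyDist (InnerProductSpace.rankOne ℂ ψ ψ) = volume.withDensity fun x => ‖ψ x‖ₑ ^ 2 := by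
  ext B hB
  have hproj := InnerProductSpace.rankOne_comp ψ ψ (energyProj B hB)
  rw [energyProj_adjoint] at hproj
  rw [energyDist_apply (InnerProductSpace.isPositive_rankOne_self ψ) B hB, hproj,
    InnerProductSpace.comp_rankOne, posTrace_rankOne_self, enorm_energyProj_sq,
    withDensity_apply _ hB]

theorem exists_isDensityOperator_energyDist_eq {μ : Measure ℝ} [IsProbabilityMeasure μ]
    (hμ : μ ≪ volume) : ∃ ρ, IsDensityOperator ρ ∧ energyDist ρ = μ := by
  let amplitude (x : ℝ) : ℂ := (√(μ.rnDeriv volume x).toReal : ℝ)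
  have hmeas : Measurable amplitude := by fun_prop
  have hsq : ∀ᵐ x, ‖amplitude x‖ₑ ^ 2 = μ.rnDeriv volume x := by
    filter_upwards [μ.rnDeriv_lt_top volume] with x hx
    rw [← ofReal_norm, ← ENNReal.ofReal_pow (norm_nonneg _), Complex.norm_real, Real.norm_eq_abs,
      sq_abs, Real.sq_sqrt ENNReal.toReal_nonneg, ENNReal.ofReal_toReal hx.ne]
  have hL2 : MemLp amplitude 2 := by
    refine ⟨hmeas.aestronglyMeasurable, ?_⟩
    rw [eLpNorm_lt_top_iff_lintegral_rpow_enorm_lt_top two_ne_zero ENNReal.ofNat_ne_top]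
    simp only [ENNReal.toReal_ofNat, ENNReal.rpow_ofNat]
    rw [lintegral_congr_ae hsq, Measure.lintegral_rnDeriv hμ]
    exact measure_lt_top μ _
  set ρ := InnerProductSpace.rankOne ℂ (hL2.toLp amplitude) (hL2.toLp amplitude)
  have hρ : ρ.IsPositive := InnerProductSpace.isPositive_rankOne_self _
  have hdist : energyDist ρ = μ := by
    rw [energyDist_rankOne_self]
    conv_rhs => rw [← Measure.withDensity_rnDeriv_eq μ volume hμ]
    refine withDensity_congr_ae ?_
    filter_upwards [hL2.coeFn_toLp, hsq] with x hx hsqx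
    rw [hx, hsqx]
  exact ⟨ρ, ⟨hρ, by rw [← energyDist_univ hρ, hdist, measure_univ]⟩, hdist⟩

theorem exists_isDensityOperator_dispersion_eq {s : ℝ} (hs : 0 < s) :
    ∃ ρ, IsDensityOperator ρ ∧ MemLp id 2 (energyDist ρ) ∧ dispersion ρ = ENNReal.ofReal s := by
  have hvar : (s ^ 2).toNNReal ≠ 0 := by simpa using hs.ne'
  obtain ⟨ρ, hρ, hdist⟩ :=
    exists_isDensityOperator_energyDist_eq (gaussianReal_absolutelyContinuous 0 hvar)
  have hL2 : MemLp id 2 (gaussianReal 0 (s ^ 2).toNNReal) := memLp_id_gaussianReal 2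
  refine ⟨ρ, hρ, hdist ▸ hL2, ?_⟩
  rw [dispersion, hdist, ← hL2.ofReal_variance_eq, variance_id_gaussianReal,
    Real.coe_toNNReal _ (sq_nonneg s), ENNReal.ofReal_rpow_of_nonneg (sq_nonneg s) (by norm_num),
    ← Real.sqrt_eq_rpow, Real.sqrt_sq hs.le]

end EnergyDistribution

section Convolution

theorem conv_finsetSum_smul_dirac {κ : Type*} (μ : Measure ℝ) [SFinite μ] (s : Finset κ)
    (c : κ → ℝ≥0∞) (a : κ → ℝ) :
    μ ∗ (∑ k ∈ s, c k • Measure.dirac (a k)) = ∑ k ∈ s, c k • μ.map (· + a k) := by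
  classical
  induction s using Finset.induction_on with
  | empty => simp
  | insert k s hk ih =>
    have hfinite : SFinite (∑ k ∈ s, c k • Measure.dirac (a k)) := by
      rw [← Measure.sum_coe_finset]
      infer_instance
    rw [Finset.sum_insert hk, Finset.sum_insert hk, Measure.conv_add, ih,
      Measure.conv_smul_right, Measure.conv_dirac]

variable {μ ν : Measure ℝ} [IsProbabilityMeasure μ] [IsProbabilityMeasure ν]

theorem memLp_id_conv_iff {p : ℝ≥0∞} (hν : MemLp id p ν) :
    MemLp id p (μ ∗ ν) ↔ MemLp id p μ := by
  have hsnd : MemLp (fun x : ℝ × ℝ => x.2) p (μ.prod ν) := hν.comp_snd μ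
  rw [Measure.conv, memLp_map_measure_iff aestronglyMeasurable_id (by fun_prop)]
  refine ⟨fun hsum => ?_, fun hμ => (hμ.comp_fst ν).add hsnd⟩
  have hfst : MemLp (fun x : ℝ × ℝ => x.1) p (μ.prod ν) := by
    convert! hsum.sub hsnd using 2 with x
    simp
  rwa [← (measurePreserving_fst (μ := μ) (ν := ν)).map_eq,
    memLp_map_measure_iff aestronglyMeasurable_id (by fun_prop)]

theorem integral_id_conv (hμ : Integrable id μ) (hν : Integrable id ν) :
    ∫ x, x ∂(μ ∗ ν) = ∫ x, x ∂μ + ∫ x, x ∂ν := by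
  calc ∫ x, x ∂(μ ∗ ν)
      = ∫ x : ℝ × ℝ, x.1 + x.2 ∂(μ.prod ν) :=
        integral_map (by fun_prop) aestronglyMeasurable_id
    _ = ∫ x : ℝ × ℝ, x.1 ∂(μ.prod ν) + ∫ x : ℝ × ℝ, x.2 ∂(μ.prod ν) :=
        integral_add (hμ.comp_fst ν) (hν.comp_snd μ)
    _ = ∫ x, x ∂μ + ∫ x, x ∂ν := by
        rw [integral_fun_fst fun x => x, integral_fun_snd fun x => x]
        simp only [probReal_univ, one_smul]

theorem variance_id_conv (hμ : MemLp id 2 μ) (hν : MemLp id 2 ν) :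
    variance id (μ ∗ ν) = variance id μ + variance id ν := by
  have hindep : IndepFun (fun x : ℝ × ℝ => x.1) (fun x => x.2) (μ.prod ν) :=
    indepFun_prod measurable_id measurable_id
  calc variance id (μ ∗ ν)
      = variance (fun x : ℝ × ℝ => x.1 + x.2) (μ.prod ν) :=
        variance_map aemeasurable_id (by fun_prop)
    _ = variance (fun x : ℝ × ℝ => x.1) (μ.prod ν) + variance (fun x => x.2) (μ.prod ν) :=
        hindep.variance_add (hμ.comp_fst ν) (hν.comp_snd μ)
    _ = variance id μ + variance id ν :=
        congrArg₂ (· + ·)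
          (measurePreserving_fst.variance_fun_comp (f := id) aemeasurable_id)
          (measurePreserving_snd.variance_fun_comp (f := id) aemeasurable_id)

theorem ofReal_variance_le_evariance_conv (hν : MemLp id 2 ν) :
    ENNReal.ofReal (variance id ν) ≤ evariance id (μ ∗ ν) := by
  by_cases hconv : MemLp id 2 (μ ∗ ν)
  · rw [← hconv.ofReal_variance_eq, variance_id_conv ((memLp_id_conv_iff hν).1 hconv) hν]
    exact ENNReal.ofReal_le_ofReal (le_add_of_nonneg_left (variance_nonneg _ _))
  · exact le_top.trans_eq (evariance_eq_top aestronglyMeasurable_id hconv).symm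

end Convolution

section Interference

variable {ι : Type*} [Fintype ι] [DecidableEq ι] {ε : ι → ℝ} {V ρ A : Matrix ι ι ℂ}

/-- The spectral projection `1_{e}(H_S)` onto the energy level `e`; it is `0` when `e` is not an
energy of the system. -/
noncomputable def levelProj (ε : ι → ℝ) (e : ℝ) : Matrix ι ι ℂ :=
  Matrix.diagonal fun i => if ε i = e then 1 else 0

theorem apply_eq_zero_of_commute_sysHam (hA : Commute A (sysHam ε)) {j k : ι} (hjk : ε j ≠ ε k) :
    A j k = 0 := by
  have hentry : A j k * ε k = ε j * A j k := by
    simpa only [sysHam, Matrix.mul_diagonal, Matrix.diagonal_mul] using congrFun₂ hA.eq j k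
  have hgap : ((ε j : ℂ) - ε k) * A j k = 0 := by linear_combination -hentry
  exact (mul_eq_zero.1 hgap).resolve_left (by exact_mod_cast sub_ne_zero.2 hjk)

theorem commute_levelProj_of_commute_sysHam (hA : Commute A (sysHam ε)) (e : ℝ) :
    Commute A (levelProj ε e) := by
  ext j k
  rw [levelProj, Matrix.mul_diagonal, Matrix.diagonal_mul]
  by_cases hjk : ε j = ε k
  · rw [hjk, mul_comm]
  · rw [apply_eq_zero_of_commute_sysHam hA hjk, zero_mul, mul_zero]

theorem commute_conjTranspose_mul_levelProj_mul_sysHam (hV : V ∈ Matrix.unitaryGroup ι ℂ)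
    (hW : Commute (workOp ε V) (sysHam ε)) (e : ℝ) :
    Commute (V.conjTranspose * levelProj ε e * V) (sysHam ε) := by
  let φ := Unitary.conjStarAlgAut ℂ (Matrix ι ι ℂ) ⟨V, hV⟩
  have hφ (X : Matrix ι ι ℂ) : φ.symm X = V.conjTranspose * X * V :=
    Unitary.conjStarAlgAut_symm_apply _ _
  have hsymm : Commute (φ.symm (sysHam ε)) (sysHam ε) := by
    have hsub := (Commute.refl (sysHam ε)).sub_left hW
    rwa [workOp, sub_sub_cancel, ← hφ] at hsub
  have hmap : Commute (φ (sysHam ε)) (sysHam ε) := by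
    simpa only [StarAlgEquiv.apply_symm_apply] using (hsymm.map φ).symm
  have hlevel := (commute_levelProj_of_commute_sysHam hmap e).map φ.symm
  rw [StarAlgEquiv.symm_apply_apply, hφ] at hlevel
  exact hlevel.symm

/-- The joint probability, in the two-point measurement scheme, that an energy measurement gives
`e` and that, after the unitary `V`, a measurement in the energy eigenbasis gives `i`. -/
noncomputable def transitionProb (ε : ι → ℝ) (V ρ : Matrix ι ι ℂ) (i : ι) (e : ℝ) : ℝ :=
  (((V * levelProj ε e) * ρ * (V * levelProj ε e).conjTranspose) i i).re

theorem transitionProb_nonneg (hρ : ρ.PosSemidef) (i : ι) (e : ℝ) :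
    0 ≤ transitionProb ε V ρ i e :=
  (Complex.nonneg_iff.1 (hρ.mul_mul_conjTranspose_same (V * levelProj ε e)).diag_nonneg).1

theorem ofReal_transitionProb (hρ : ρ.PosSemidef) (i : ι) (e : ℝ) :
    (transitionProb ε V ρ i e : ℂ)
      = ∑ j, ∑ k, if ε j = e ∧ ε k = e then V i j * ρ j k * star (V i k) else 0 := by
  have hnonneg := (hρ.mul_mul_conjTranspose_same (V * levelProj ε e)).diag_nonneg (i := i)
  rw [transitionProb, ← (Complex.eq_re_of_ofReal_le hnonneg), Matrix.mul_apply]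
  simp only [Matrix.mul_apply (M := V * levelProj ε e), Finset.sum_mul]
  rw [Finset.sum_comm]
  refine Finset.sum_congr rfl fun j _ => Finset.sum_congr rfl fun k _ => ?_
  rw [Matrix.conjTranspose_apply, levelProj, Matrix.mul_diagonal, Matrix.mul_diagonal]
  split_ifs <;> simp_all

variable {M : Type*} [AddCommMonoid M] [Module ℂ M]

theorem sum_transitionProb_smul (hρ : ρ.PosSemidef) (i : ι) (g : ℝ → M) :
    ∑ e ∈ Finset.univ.image ε, (transitionProb ε V ρ i e : ℂ) • g e
      = ∑ j, ∑ k, if ε j = ε k then (V i j * ρ j k * star (V i k)) • g (ε j) else 0 := by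
  simp only [ofReal_transitionProb hρ, Finset.sum_smul]
  rw [Finset.sum_comm]
  refine Finset.sum_congr rfl fun j _ => ?_
  rw [Finset.sum_comm]
  refine Finset.sum_congr rfl fun k _ => ?_
  rw [Finset.sum_eq_single_of_mem (ε j) (Finset.mem_image_of_mem ε (Finset.mem_univ j))
    fun e _ he => by rw [if_neg fun h => he h.1.symm, zero_smul]]
  simp only [true_and, ite_smul, zero_smul, eq_comm (a := ε k)]

theorem sum_interference_smul_eq_zero (hV : V ∈ Matrix.unitaryGroup ι ℂ)
    (hinc : Commute (workOp ε V) (sysHam ε) ∨ Commute ρ (sysHam ε)) {j k : ι} (hjk : ε j ≠ ε k)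
    (g : ℝ → M) : ∑ i, (V i j * ρ j k * star (V i k)) • g (ε i) = 0 := by
  rcases hinc with hW | hρ
  · have hfiber (e : ℝ) : ∑ i with ε i = e, V i j * ρ j k * star (V i k) = 0 := by
      calc ∑ i with ε i = e, V i j * ρ j k * star (V i k)
          = ρ j k * (V.conjTranspose * levelProj ε e * V) k j := by
            rw [Matrix.mul_apply, Finset.mul_sum, Finset.sum_filter]
            refine Finset.sum_congr rfl fun i _ => ?_
            rw [levelProj, Matrix.mul_diagonal, Matrix.conjTranspose_apply]
            split_ifs <;> ring
        _ = 0 := by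
            rw [apply_eq_zero_of_commute_sysHam
              (commute_conjTranspose_mul_levelProj_mul_sysHam hV hW e) hjk.symm, mul_zero]
    rw [← Finset.sum_fiberwise_of_maps_to fun i hi => Finset.mem_image_of_mem ε hi]
    refine Finset.sum_eq_zero fun e _ => ?_
    calc ∑ i with ε i = e, (V i j * ρ j k * star (V i k)) • g (ε i)
        = ∑ i with ε i = e, (V i j * ρ j k * star (V i k)) • g e :=
          Finset.sum_congr rfl fun i hi => by rw [(Finset.mem_filter.1 hi).2]
      _ = 0 := by rw [← Finset.sum_smul, hfiber, zero_smul]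
  · simp only [apply_eq_zero_of_commute_sysHam hρ hjk, mul_zero, zero_mul, zero_smul,
      Finset.sum_const_zero]

theorem sum_smul_eq_sum_transitionProb_smul (hV : V ∈ Matrix.unitaryGroup ι ℂ)
    (hρ : ρ.PosSemidef) (hinc : Commute (workOp ε V) (sysHam ε) ∨ Commute ρ (sysHam ε))
    (G : ℝ → ℝ → ℝ → M) :
    ∑ i, ∑ j, ∑ k, (V i j * ρ j k * star (V i k)) • G (ε i) (ε j) (ε k)
      = ∑ p ∈ Finset.univ ×ˢ Finset.univ.image ε,
          (transitionProb ε V ρ p.1 p.2 : ℂ) • G (ε p.1) p.2 p.2 := by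
  have hcoherence (j k : ι) :
      ∑ i, (V i j * ρ j k * star (V i k)) • G (ε i) (ε j) (ε k)
        = ∑ i, if ε j = ε k then (V i j * ρ j k * star (V i k)) • G (ε i) (ε j) (ε j) else 0 := by
    split_ifs with hjk
    · rw [hjk]
    · rw [sum_interference_smul_eq_zero hV hinc hjk fun e => G e (ε j) (ε k),
        Finset.sum_const_zero]
  have hswap (f : ι → ι → ι → M) : ∑ i, ∑ j, ∑ k, f i j k = ∑ j, ∑ k, ∑ i, f i j k := by
    rw [Finset.sum_comm]
    exact Finset.sum_congr rfl fun j _ => Finset.sum_comm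
  rw [Finset.sum_product]
  simp only [sum_transitionProb_smul hρ _ fun e => G _ e e]
  refine (hswap _).trans (Eq.trans ?_ (hswap _).symm)
  exact Finset.sum_congr rfl fun j _ => Finset.sum_congr rfl fun k _ => hcoherence j k

end Interference

section WorkDistribution

variable {ι : Type*} [Fintype ι] [DecidableEq ι] {ε : ι → ℝ} {V ρ : Matrix ι ι ℂ}

/-- The distribution of the work `e - ε i` in the two-point measurement scheme with initial energy
`e` and final eigenstate `i`. -/
noncomputable def workDist (ε : ι → ℝ) (V ρ : Matrix ι ι ℂ) : Measure ℝ :=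
  ∑ p ∈ Finset.univ ×ˢ Finset.univ.image ε,
    ENNReal.ofReal (transitionProb ε V ρ p.1 p.2) • Measure.dirac (p.2 - ε p.1)

theorem memLp_id_workDist (p : ℝ≥0∞) : MemLp id p (workDist ε V ρ) := by
  have hfinite : IsFiniteMeasure (workDist ε V ρ) := by
    have hatom (q : ι × ℝ) := (Measure.dirac (q.2 - ε q.1)).smul_finite
      (ENNReal.ofReal_ne_top (r := transitionProb ε V ρ q.1 q.2))
    unfold workDist
    infer_instance
  refine MemLp.of_bound aestronglyMeasurable_id
    (∑ q ∈ Finset.univ ×ˢ Finset.univ.image ε, ‖q.2 - ε q.1‖) ?_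
  refine ae_finsetSum_measure_iff.2 fun q hq => Measure.ae_smul_measure ?_ _
  rw [ae_dirac_eq]
  exact Finset.single_le_sum (f := fun q => ‖q.2 - ε q.1‖) (fun _ _ => norm_nonneg _) hq

theorem integral_workDist (hρ : ρ.PosSemidef) (f : ℝ → ℝ) :
    ∫ x, f x ∂(workDist ε V ρ)
      = ∑ p ∈ Finset.univ ×ˢ Finset.univ.image ε,
          transitionProb ε V ρ p.1 p.2 * f (p.2 - ε p.1) := by
  rw [workDist, integral_finsetSum_measure fun _ _ =>
    (integrable_dirac (by finiteness)).smul_measure ENNReal.ofReal_ne_top]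
  refine Finset.sum_congr rfl fun p _ => ?_
  rw [integral_smul_measure, integral_dirac, smul_eq_mul,
    ENNReal.toReal_ofReal (transitionProb_nonneg hρ _ _)]

theorem integral_mul_workDist (hV : V ∈ Matrix.unitaryGroup ι ℂ) (hρ : ρ.PosSemidef)
    (hinc : Commute (workOp ε V) (sysHam ε) ∨ Commute ρ (sysHam ε)) {A B : Matrix ι ι ℂ}
    {a b : ℝ → ℝ} (hA : ∀ i j, A i j = V i j * a (ε j - ε i))
    (hB : ∀ i j, B i j = V i j * b (ε j - ε i)) :
    ((∫ x, a x * b x ∂(workDist ε V ρ) : ℝ) : ℂ) = (A * ρ * B.conjTranspose).trace := by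
  have hpaths := sum_smul_eq_sum_transitionProb_smul hV hρ hinc
    fun x y z => ((a (y - x) * b (z - x) : ℝ) : ℂ)
  simp only [smul_eq_mul] at hpaths
  rw [integral_workDist hρ fun x => a x * b x]
  push_cast at hpaths ⊢
  rw [← hpaths, Matrix.trace]
  simp only [Matrix.diag_apply, Matrix.mul_apply (M := A * ρ), Matrix.mul_apply (M := A),
    Finset.sum_mul, Matrix.conjTranspose_apply, hA, hB]
  refine Finset.sum_congr rfl fun i _ => ?_
  rw [Finset.sum_comm]
  refine Finset.sum_congr rfl fun k _ => Finset.sum_congr rfl fun j _ => ?_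
  have hstar : star (b (ε k - ε i) : ℂ) = b (ε k - ε i) := Complex.conj_ofReal _
  rw [star_mul', hstar]
  ring

theorem mul_workOp_apply (hV : V ∈ Matrix.unitaryGroup ι ℂ) (i j : ι) :
    (V * workOp ε V) i j = V i j * (ε j - ε i : ℝ) := by
  have hmul : V * workOp ε V = V * sysHam ε - sysHam ε * V := by
    rw [workOp, mul_sub, ← mul_assoc, ← mul_assoc, ← Matrix.star_eq_conjTranspose,
      Matrix.mem_unitaryGroup_iff.1 hV, one_mul]
  rw [hmul, Matrix.sub_apply, sysHam, Matrix.mul_diagonal, Matrix.diagonal_mul]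
  push_cast
  ring

theorem trace_mul_mul_conjTranspose_of_mem_unitaryGroup (hV : V ∈ Matrix.unitaryGroup ι ℂ)
    (A : Matrix ι ι ℂ) : (V * A * V.conjTranspose).trace = A.trace := by
  rw [Matrix.trace_mul_cycle, ← Matrix.star_eq_conjTranspose, Matrix.mem_unitaryGroup_iff'.1 hV,
    one_mul]

theorem isProbabilityMeasure_workDist (hV : V ∈ Matrix.unitaryGroup ι ℂ) (hρ : IsDensityMatrix ρ)
    (hinc : Commute (workOp ε V) (sysHam ε) ∨ Commute ρ (sysHam ε)) :
    IsProbabilityMeasure (workDist ε V ρ) := by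
  have htotal := integral_mul_workDist hV hρ.posSemidef hinc (A := V) (B := V)
    (a := fun _ => 1) (b := fun _ => 1) (by simp) (by simp)
  rw [trace_mul_mul_conjTranspose_of_mem_unitaryGroup hV, hρ.trace_eq_one] at htotal
  have hreal : (workDist ε V ρ).real Set.univ = 1 := by
    simpa using htotal
  exact ⟨by rwa [Measure.real, ENNReal.toReal_eq_one_iff] at hreal⟩

theorem integral_id_workDist (hV : V ∈ Matrix.unitaryGroup ι ℂ) (hρ : ρ.PosSemidef)
    (hinc : Commute (workOp ε V) (sysHam ε) ∨ Commute ρ (sysHam ε)) :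
    ∫ x, x ∂(workDist ε V ρ) = sysMean ρ (workOp ε V) := by
  have htrace := integral_mul_workDist hV hρ hinc (A := V * workOp ε V) (B := V)
    (a := fun x => x) (b := fun _ => 1) (mul_workOp_apply hV) (by simp)
  rw [mul_assoc V, trace_mul_mul_conjTranspose_of_mem_unitaryGroup hV] at htrace
  simpa only [sysMean, mul_one, Complex.ofReal_re] using congrArg Complex.re htrace

theorem integral_sq_workDist (hV : V ∈ Matrix.unitaryGroup ι ℂ) (hρ : ρ.PosSemidef)
    (hinc : Commute (workOp ε V) (sysHam ε) ∨ Commute ρ (sysHam ε)) :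
    ∫ x, x ^ 2 ∂(workDist ε V ρ) = sysMean ρ (workOp ε V * workOp ε V) := by
  have hW : (workOp ε V).conjTranspose = workOp ε V := by
    simp [workOp, sysHam, Matrix.conjTranspose_mul, mul_assoc, Pi.star_def]
  have htrace := integral_mul_workDist hV hρ hinc (A := V * workOp ε V) (B := V * workOp ε V)
    (a := fun x => x) (b := fun x => x) (mul_workOp_apply hV) (mul_workOp_apply hV)
  have hcyclic : (V * workOp ε V * ρ * (V * workOp ε V).conjTranspose).trace
      = (workOp ε V * workOp ε V * ρ).trace := by
    rw [Matrix.conjTranspose_mul, hW, ← mul_assoc, mul_assoc V, mul_assoc V,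
      trace_mul_mul_conjTranspose_of_mem_unitaryGroup hV, Matrix.trace_mul_comm, mul_assoc]
  rw [hcyclic] at htrace
  simpa only [sysMean, sq, Complex.ofReal_re] using congrArg Complex.re htrace

theorem variance_id_workDist (hV : V ∈ Matrix.unitaryGroup ι ℂ) (hρ : IsDensityMatrix ρ)
    (hinc : Commute (workOp ε V) (sysHam ε) ∨ Commute ρ (sysHam ε)) :
    variance id (workDist ε V ρ) = sysVar ρ (workOp ε V) := by
  have hprob := isProbabilityMeasure_workDist hV hρ hinc
  rw [variance_eq_sub (memLp_id_workDist 2), sysVar, ← integral_sq_workDist hV hρ.posSemidef hinc,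
    ← integral_id_workDist hV hρ.posSemidef hinc]
  rfl

end WorkDistribution

section Protocol

variable {ι : Type*} [Fintype ι]

theorem braOp_ketOp [DecidableEq ι] (i j : ι) (ψ : WeightSpace) :
    braOp i (ketOp j ψ) = if i = j then ψ else 0 := by
  rw [ketOp_apply, braOp, PiLp.proj_apply, PiLp.single_apply]

theorem braOp_comp_tensorOp (A : Matrix ι ι ℂ) (T : WeightSpace →L[ℂ] WeightSpace) (i : ι) :
    braOp i ∘L tensorOp A T = ∑ j, A i j • (T ∘L braOp j) := by
  classical
  ext1 Ψ
  simp [tensorOp, braOp_ketOp]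

theorem braOp_comp_tensorOp_comp_ketOp (A : Matrix ι ι ℂ) (T : WeightSpace →L[ℂ] WeightSpace)
    (i j : ι) : braOp i ∘L tensorOp A T ∘L ketOp j = A i j • T := by
  classical
  rw [← ContinuousLinearMap.comp_assoc, braOp_comp_tensorOp]
  ext1 ψ
  simp [braOp_ketOp, apply_ite]

theorem braOp_comp_shiftOp (ε : ι → ℝ) (i : ι) :
    braOp i ∘L shiftOp ε = displacement (ε i) ∘L braOp i := by
  classical
  ext1 Ψ
  simp [shiftOp, braOp_ketOp]

theorem shiftOp_comp_ketOp (ε : ι → ℝ) (i : ι) :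
    shiftOp ε ∘L ketOp i = ketOp i ∘L displacement (ε i) := by
  classical
  ext1 ψ
  simp [shiftOp, braOp_ketOp, apply_ite]

theorem braOp_comp_adjoint_shiftOp (ε : ι → ℝ) (i : ι) :
    braOp i ∘L adjoint (shiftOp ε) = displacement (-ε i) ∘L braOp i := by
  simpa only [ketOp, ContinuousLinearMap.adjoint_comp, ContinuousLinearMap.adjoint_adjoint,
    adjoint_displacement] using congrArg adjoint (shiftOp_comp_ketOp ε i)

theorem braOp_comp_protocolUnitary (ε : ι → ℝ) (V : Matrix ι ι ℂ) (i : ι) :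
    braOp i ∘L protocolUnitary ε V = ∑ j, V i j • (displacement (ε j - ε i) ∘L braOp j) := by
  calc braOp i ∘L protocolUnitary ε V
      = displacement (-ε i) ∘L (braOp i ∘L tensorOp V (.id ℂ WeightSpace)) ∘L shiftOp ε := by
        rw [protocolUnitary, ← ContinuousLinearMap.comp_assoc, braOp_comp_adjoint_shiftOp]
        simp only [ContinuousLinearMap.comp_assoc]
    _ = ∑ j, V i j • (displacement (ε j - ε i) ∘L braOp j) := by
        simp only [braOp_comp_tensorOp, ContinuousLinearMap.id_comp,
          ContinuousLinearMap.finsetSum_comp, ContinuousLinearMap.comp_finsetSum,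
          ContinuousLinearMap.smul_comp, ContinuousLinearMap.comp_smul, braOp_comp_shiftOp,
          ← ContinuousLinearMap.comp_assoc, displacement_comp_displacement, neg_add_eq_sub]

theorem finalWeight_eq_sum (ε : ι → ℝ) (V ρS : Matrix ι ι ℂ)
    (ρW : WeightSpace →L[ℂ] WeightSpace) :
    finalWeight ε V ρS ρW = ∑ i, ∑ j, ∑ k, (V i j * ρS j k * star (V i k)) •
      (displacement (ε j - ε i) ∘L ρW ∘L adjoint (displacement (ε k - ε i))) := by
  refine Finset.sum_congr rfl fun i _ => ?_
  have hket : adjoint (protocolUnitary ε V) ∘L ketOp i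
      = ∑ k, star (V i k) • (ketOp k ∘L adjoint (displacement (ε k - ε i))) := by
    rw [ketOp, ← ContinuousLinearMap.adjoint_comp, braOp_comp_protocolUnitary, map_sum]
    simp only [map_smulₛₗ, ContinuousLinearMap.adjoint_comp, ketOp, starRingEnd_apply]
  calc braOp i ∘L (protocolUnitary ε V ∘L tensorOp ρS ρW ∘L
        adjoint (protocolUnitary ε V)) ∘L ketOp i
      = (braOp i ∘L protocolUnitary ε V) ∘L tensorOp ρS ρW ∘L
          (adjoint (protocolUnitary ε V) ∘L ketOp i) := by
        simp only [ContinuousLinearMap.comp_assoc]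
    _ = ∑ j, ∑ k, (V i j * star (V i k)) • (displacement (ε j - ε i) ∘L
          (braOp j ∘L tensorOp ρS ρW ∘L ketOp k) ∘L adjoint (displacement (ε k - ε i))) := by
        rw [braOp_comp_protocolUnitary, hket]
        simp only [ContinuousLinearMap.finsetSum_comp, ContinuousLinearMap.comp_finsetSum,
          ContinuousLinearMap.smul_comp, ContinuousLinearMap.comp_smul, Finset.smul_sum, smul_smul,
          ContinuousLinearMap.comp_assoc]
        rw [Finset.sum_comm]
        simp only [mul_comm]
    _ = _ := by
        simp only [braOp_comp_tensorOp_comp_ketOp, ContinuousLinearMap.smul_comp,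
          ContinuousLinearMap.comp_smul, smul_smul, mul_right_comm]

variable [DecidableEq ι] {ε : ι → ℝ} {V ρS : Matrix ι ι ℂ} {ρW : WeightSpace →L[ℂ] WeightSpace}

theorem finalWeight_eq_sum_transitionProb_smul (hV : V ∈ Matrix.unitaryGroup ι ℂ)
    (hρS : ρS.PosSemidef) (hinc : Commute (workOp ε V) (sysHam ε) ∨ Commute ρS (sysHam ε))
    (ρW : WeightSpace →L[ℂ] WeightSpace) :
    finalWeight ε V ρS ρW = ∑ p ∈ Finset.univ ×ˢ Finset.univ.image ε,
      (transitionProb ε V ρS p.1 p.2 : ℂ) •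
        (displacement (p.2 - ε p.1) ∘L ρW ∘L adjoint (displacement (p.2 - ε p.1))) := by
  rw [finalWeight_eq_sum]
  exact sum_smul_eq_sum_transitionProb_smul hV hρS hinc fun x y z =>
    displacement (y - x) ∘L ρW ∘L adjoint (displacement (z - x))

theorem energyDist_finalWeight (hV : V ∈ Matrix.unitaryGroup ι ℂ) (hρS : ρS.PosSemidef)
    (hinc : Commute (workOp ε V) (sysHam ε) ∨ Commute ρS (sysHam ε)) (hρW : IsDensityOperator ρW) :
    energyDist (finalWeight ε V ρS ρW) = energyDist ρW ∗ workDist ε V ρS := by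
  have hprob := hρW.isProbabilityMeasure_energyDist
  have hnonneg (p : ι × ℝ) : 0 ≤ transitionProb ε V ρS p.1 p.2 := transitionProb_nonneg hρS _ _
  have hpos (p : ι × ℝ) := hρW.isPositive.conj_adjoint (displacement (p.2 - ε p.1))
  rw [finalWeight_eq_sum_transitionProb_smul hV hρS hinc,
    energyDist_finsetSum_smul (fun p _ => hnonneg p) (fun p _ => hpos p), workDist,
    conv_finsetSum_smul_dirac]
  simp only [energyDist_displacement_comp_comp_adjoint hρW.isPositive]

end Protocol

section Moments

variable {ι : Type*} [Fintype ι] [DecidableEq ι] {ε : ι → ℝ} {V ρS : Matrix ι ι ℂ}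
  {ρW : WeightSpace →L[ℂ] WeightSpace}

theorem memLp_id_energyDist_finalWeight_iff (hV : V ∈ Matrix.unitaryGroup ι ℂ)
    (hρS : IsDensityMatrix ρS) (hinc : Commute (workOp ε V) (sysHam ε) ∨ Commute ρS (sysHam ε))
    (hρW : IsDensityOperator ρW) {p : ℝ≥0∞} :
    MemLp id p (energyDist (finalWeight ε V ρS ρW)) ↔ MemLp id p (energyDist ρW) := by
  have hprobW := hρW.isProbabilityMeasure_energyDist
  have hprobS := isProbabilityMeasure_workDist hV hρS hinc
  rw [energyDist_finalWeight hV hρS.posSemidef hinc hρW]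
  exact memLp_id_conv_iff (memLp_id_workDist p)

theorem workGain_eq_sysMean_workOp (hV : V ∈ Matrix.unitaryGroup ι ℂ) (hρS : IsDensityMatrix ρS)
    (hinc : Commute (workOp ε V) (sysHam ε) ∨ Commute ρS (sysHam ε)) (hρW : IsDensityOperator ρW)
    (hmean : Integrable id (energyDist ρW)) :
    workGain ε V ρS ρW = sysMean ρS (workOp ε V) := by
  have hprobW := hρW.isProbabilityMeasure_energyDist
  have hprobS := isProbabilityMeasure_workDist hV hρS hinc
  rw [workGain, meanEnergy, meanEnergy, energyDist_finalWeight hV hρS.posSemidef hinc hρW,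
    integral_id_conv hmean ((memLp_id_workDist 1).integrable le_rfl), add_sub_cancel_left,
    integral_id_workDist hV hρS.posSemidef hinc]

theorem varianceGain_eq_sysVar_workOp (hV : V ∈ Matrix.unitaryGroup ι ℂ)
    (hρS : IsDensityMatrix ρS) (hinc : Commute (workOp ε V) (sysHam ε) ∨ Commute ρS (sysHam ε))
    (hρW : IsDensityOperator ρW) (hL2 : MemLp id 2 (energyDist ρW)) :
    varianceGain ε V ρS ρW = sysVar ρS (workOp ε V) := by
  have hprobW := hρW.isProbabilityMeasure_energyDist
  have hprobS := isProbabilityMeasure_workDist hV hρS hinc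
  rw [varianceGain, varEnergy, varEnergy, energyDist_finalWeight hV hρS.posSemidef hinc hρW,
    variance_id_conv hL2 (memLp_id_workDist 2), add_sub_cancel_left,
    variance_id_workDist hV hρS hinc]

theorem ofReal_sqrt_sysVar_workOp_le_dispersion_finalWeight (hV : V ∈ Matrix.unitaryGroup ι ℂ)
    (hρS : IsDensityMatrix ρS) (hinc : Commute (workOp ε V) (sysHam ε) ∨ Commute ρS (sysHam ε))
    (hρW : IsDensityOperator ρW) :
    ENNReal.ofReal √(sysVar ρS (workOp ε V)) ≤ dispersion (finalWeight ε V ρS ρW) := by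
  have hprobW := hρW.isProbabilityMeasure_energyDist
  have hprobS := isProbabilityMeasure_workDist hV hρS hinc
  rw [dispersion, energyDist_finalWeight hV hρS.posSemidef hinc hρW, Real.sqrt_eq_rpow,
    ← variance_id_workDist hV hρS hinc,
    ← ENNReal.ofReal_rpow_of_nonneg (variance_nonneg _ _) (by positivity)]
  exact ENNReal.rpow_le_rpow (ofReal_variance_le_evariance_conv (memLp_id_workDist 2))
    (by positivity)

end Moments

theorem mainTheorem9 {ι : Type*} [Fintype ι] [DecidableEq ι] (ε : ι → ℝ)
    (V : Matrix ι ι ℂ) (hV : V ∈ Matrix.unitaryGroup ι ℂ)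
    (ρS : Matrix ι ι ℂ) (hρS : IsDensityMatrix ρS)
    (hinc : Commute (workOp ε V) (sysHam ε) ∨ Commute ρS (sysHam ε)) :
    -- the extracted work does not depend on the weight state
    (∀ ρW : WeightSpace →L[ℂ] WeightSpace, IsDensityOperator ρW →
      Integrable id (energyDist ρW) →
        Integrable id (energyDist (finalWeight ε V ρS ρW)) ∧
        workGain ε V ρS ρW = sysMean ρS (workOp ε V)) ∧
    -- the variance gain does not depend on the weight state
    (∀ ρW : WeightSpace →L[ℂ] WeightSpace, IsDensityOperator ρW →
      MemLp id 2 (energyDist ρW) →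
        MemLp id 2 (energyDist (finalWeight ε V ρS ρW)) ∧
        varianceGain ε V ρS ρW = sysVar ρS (workOp ε V)) ∧
    -- every initial dispersion is compatible with this work and variance gain
    (∀ s : ℝ, 0 < s →
      ∃ ρW : WeightSpace →L[ℂ] WeightSpace, IsDensityOperator ρW ∧
        MemLp id 2 (energyDist ρW) ∧ dispersion ρW = ENNReal.ofReal s ∧
        workGain ε V ρS ρW = sysMean ρS (workOp ε V) ∧
        varianceGain ε V ρS ρW = sysVar ρS (workOp ε V)) ∧
    -- the final dispersion is bounded below
    (∀ ρW : WeightSpace →L[ℂ] WeightSpace, IsDensityOperator ρW →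
      ENNReal.ofReal (Real.sqrt (sysVar ρS (workOp ε V))) ≤
        dispersion (finalWeight ε V ρS ρW)) := by
  have hmoment {ρW : WeightSpace →L[ℂ] WeightSpace} (hρW : IsDensityOperator ρW) {p : ℝ≥0∞} :=
    memLp_id_energyDist_finalWeight_iff hV hρS hinc hρW (p := p)
  refine ⟨fun ρW hρW hmean => ⟨?_, workGain_eq_sysMean_workOp hV hρS hinc hρW hmean⟩,
    fun ρW hρW hL2 => ⟨(hmoment hρW).2 hL2, varianceGain_eq_sysVar_workOp hV hρS hinc hρW hL2⟩,
    fun s hs => ?_,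
    fun ρW hρW => ofReal_sqrt_sysVar_workOp_le_dispersion_finalWeight hV hρS hinc hρW⟩
  · rw [← memLp_one_iff_integrable] at hmean ⊢
    exact (hmoment hρW).2 hmean
  · obtain ⟨ρW, hρW, hL2, hdisp⟩ := exists_isDensityOperator_dispersion_eq hs
    have hprob := hρW.isProbabilityMeasure_energyDist
    exact ⟨ρW, hρW, hL2, hdisp,
      workGain_eq_sysMean_workOp hV hρS hinc hρW (hL2.integrable one_le_two),
      varianceGain_eq_sysVar_workOp hV hρS hinc hρW hL2⟩
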